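/- Let $K\ge 2$ and $n\ge 1$ be integers and let $\alpha\in(0,1)$ satisfy $\alpha^2 n\ge 1$. Let $\mathcal P_K=\{p\in[0,1]^K:\sum_{k=1}^K p_k=1\}$ and, for $\gamma>0$, let $F_\gamma(p)=\sum_{k=1}^K p_k^\gamma$. The sensitive data $x_1,\dots,x_n$ are i.i.d. with $\mathbb P(x_i=k)=p_k$, $k\in\{1,\dots,K\}$. An $\alpha$-locally differentially private ($\alpha$-LDP) mechanism $Q=(Q_1,\dots,Q_n)$ (interaction allowed) releases successively $Z_1,\dots,Z_n$, with values in arbitrary measurable spaces, where $Z_i$ is drawn from a conditional distribution $Q_i(\cdot\mid x_i,Z_1,\dots,Z_{i-1})$ such that, for every $i$, \[ Q_i(A\mid x,z_1,\dots,z_{i-1})\le e^{\alpha}\,Q_i(A\mid x',z_1,\dots,z_{i-1}) \] for all measurable $A$, all $x,x'\in\{1,\dots,K\}$ and all $z_1,\dots,z_{i-1}$. An estimator $\hat F$ is a measurable real-valued function of $(Z_1,\dots,Z_n)$. Consider the minimax quadratic risk \[ \mathcal R_\gamma(K,n,\alpha)=\inf_{Q,\hat F}\ \sup_{p\in\mathcal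 P_K}\ \mathbb E_p\big[(\hat F-F_\gamma(p))^2\big], \] where the infimum is over all $\alpha$-LDP mechanisms $Q$ and all estimators $\hat F$. Then for every $\gamma\in(0,1)\cup(1,2)$ there is a constant $c_\gamma>0$, depending only on $\gamma$, such that for all such $K,n,\alpha$: 1) if $\gamma\in(0,1)$, \[ \mathcal R_\gamma(K,n,\alpha)\ \ge\ c_\gamma\,\min\left\{K^{2(1-\gamma)},\ \frac{K^{2-\gamma}}{\big(n(e^{2\alpha}-e^{-2\alpha})^2\big)^{\gamma}}\right\}; \] 2) if $\gamma\in(1,2)$, \[ \mathcal R_\gamma(K,n,\alpha)\ \ge\ c_\gamma\,\min\left\{\frac{1}{\big[(e^{2\alpha}-e^{-2\alpha})^2 n\big]^{2(\gamma-1)}},\ \frac{K^{2-\gamma}}{\big[(e^{2\alpha}-e^{-2\alpha})^2 n\big]^{\gamma}}\right\}. \] -/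

import Mathlib

open MeasureTheory ProbabilityTheory
open scoped ENNReal

universe u

namespace LDP

/-- The space of histories `(Z_0, …, Z_{i-1})`, as an iterated product (a point for `i = 0`). -/
def Hist (Z : ℕ → Type u) : ℕ → Type u
  | 0 => PUnit
  | i + 1 => Hist Z i × Z i

/-- The product `σ`-algebra on the space of histories. -/
instance instMeasurableSpaceHist (Z : ℕ → Type u) [m : ∀ i, MeasurableSpace (Z i)] :
    ∀ i, MeasurableSpace (Hist Z i)
  | 0 => (⊤ : MeasurableSpace PUnit)
  | i + 1 => (instMeasurableSpaceHist Z i).prod (m i)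

/-- A sequentially interactive `α`-locally differentially private mechanism for `n` individuals
with data in `Fin K`. Individual `i` (numbered from `0`) releases a random element of an arbitrary
measurable space `Z i`, drawn from `Q i (Z_0, …, Z_{i-1}, x_i)`. Only the rounds `i < n` matter:
those with `n ≤ i` do not enter the law of the released sample and are unconstrained. -/
structure Mechanism (K n : ℕ) (α : ℝ) where
  Z : ℕ → Type u
  [measZ : ∀ i, MeasurableSpace (Z i)]
  Q : ∀ i, Kernel (Hist Z i × Fin K) (Z i)
  [markov : ∀ i, IsMarkovKernel (Q i)]
  ldp : ∀ i < n, ∀ (h : Hist Z i) (x x' : Fin K) (A : Set (Z i)), MeasurableSet A →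
    Q i (h, x) A ≤ ENNReal.ofReal (Real.exp α) * Q i (h, x') A

attribute [instance] Mechanism.measZ Mechanism.markov

/-- The distribution on `Fin K` of one sensitive observation, `ℙ (x = k) = p k`. -/
noncomputable def dataLaw {K : ℕ} (p : Fin K → ℝ) : Measure (Fin K) :=
  ∑ k, ENNReal.ofReal (p k) • Measure.dirac k

/-- The law of `(Z_0, …, Z_{i-1})` when the sensitive data are i.i.d. with distribution `p`:
given the history, `x_i` is drawn from `p` independently of it, then `Z_i` is drawn from
`Q i (history, x_i)`, and `x_i` is forgotten. -/
noncomputable def Mechanism.law {K n : ℕ} {α : ℝ} (M : Mechanism.{u} K n α) (p : Fin K → ℝ) :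
    ∀ i, Measure (Hist M.Z i)
  | 0 => Measure.dirac PUnit.unit
  | i + 1 => (((M.law p i).prod (dataLaw p)).compProd (M.Q i)).map
      (fun w : (Hist M.Z i × Fin K) × M.Z i => ((w.1.1, w.2) : Hist M.Z i × M.Z i))

/-- The power sum functional `F_γ(p) = ∑ k, p_k ^ γ`. -/
noncomputable def powerSum {K : ℕ} (γ : ℝ) (p : Fin K → ℝ) : ℝ := ∑ k, p k ^ γ

/-- An estimator is a measurable real function of the released sample `(Z_0, …, Z_{n-1})`. -/
def Mechanism.Estimator {K n : ℕ} {α : ℝ} (M : Mechanism.{u} K n α) : Type u :=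
  {F : Hist M.Z n → ℝ // Measurable F}

/-- The quadratic risk `𝔼_p (F̂ - F_γ(p))²`, with values in `[0, ∞]`. -/
noncomputable def Mechanism.risk {K n : ℕ} {α : ℝ} (M : Mechanism.{u} K n α) (F : M.Estimator)
    (γ : ℝ) (p : Fin K → ℝ) : ℝ≥0∞ :=
  ∫⁻ z, ENNReal.ofReal ((F.1 z - powerSum γ p) ^ 2) ∂(M.law p n)

/-- The minimax quadratic risk: infimum over all `α`-LDP mechanisms and all estimators of the
supremum of the risk over all probability vectors of size `K`. -/
noncomputable def minimaxRisk (γ : ℝ) (K n : ℕ) (α : ℝ) : ℝ≥0∞ :=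
  ⨅ (M : Mechanism.{u} K n α) (F : M.Estimator), ⨆ p ∈ stdSimplex ℝ (Fin K), M.risk F γ p

/-- The privacy factor `(e^{2α} - e^{-2α})²`. -/
noncomputable def privacyFactor (α : ℝ) : ℝ := (Real.exp (2 * α) - Real.exp (-2 * α)) ^ 2

end LDP

/-! Fix a mechanism. A reference vector `p₀` is compared with perturbations `p ω` whose power sums
all differ from that of `p₀` by the same amount. It suffices that one `ω`, which may depend on the
mechanism, gives a released sample with relative entropy at most `1/2` from the sample under `p₀`; a
two-point bound then forces a large risk at `p₀` or at `p ω` (`ofReal_le_minimaxRisk`).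

Privacy enters one round at a time. The densities of a release given the datum, relative to the law
under `p₀`, lie in `[e^{-α}, e^α]`, so a release sees `p ω - p₀` only through a test function of
size at most `e^α - 1`. With the `p₀` law as first argument of the relative entropy, histories
follow one law common to all `ω`, so averaging over `ω` is possible at each outcome despite the
interaction. One round costs at most `e^α (e^α - 1)² v` on average, where `v` is the mean square
variation (`exists_likelihood_mixStep`).

The main family has `m` pairs of cells of mass `δ`, changed to `(2δ, 0)` or `(0, 2δ)`. Independent
signs are orthogonal, so `v = 4 m δ²`, while the power sum moves by `m δ^γ (2^γ - 2)` whatever the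
signs. With `N = n (e^{2α} - e^{-2α})²`, the constraints are `m N δ² ≲ 1` and `m δ ≲ 1`. For `3 ≤ K
≤ N`, `m ≍ K` and `δ ≍ (K N)^{-1/2}` give `K^{2-γ} / N^γ`. For `K ≥ N`, take `m ≍ K`, `δ ≍ 1/K` if
`γ < 1`, and `m ≍ N`, `δ ≍ 1/N` if `γ > 1`. When `K = 2` there is no room for a pair and a spare
cell, and two point hypotheses suffice. -/

namespace LDP

/-! ### Densities of mutually dominated measures -/

/-- Two finite measures that dominate each other up to a factor `C` have a density which takes
values in `[C⁻¹, C]`. -/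
lemma exists_density_of_le_smul {X : Type*} [MeasurableSpace X] (μ ν : Measure X)
    [IsFiniteMeasure μ] [IsFiniteMeasure ν] {C : ℝ} (hC : 1 ≤ C)
    (h₁ : μ ≤ ENNReal.ofReal C • ν) (h₂ : ν ≤ ENNReal.ofReal C • μ) :
    ∃ g : X → ℝ, Measurable g ∧ (∀ x, C⁻¹ ≤ g x ∧ g x ≤ C) ∧
      μ = ν.withDensity (fun x => ENNReal.ofReal (g x)) := by
  have hC0 : 0 < C := by linarith
  have hac : μ ≪ ν := Measure.absolutelyContinuous_of_le_smul h₁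
  have hμ := Measure.withDensity_rnDeriv_eq μ ν hac
  have hmeas := Measure.measurable_rnDeriv μ ν
  have hup : μ.rnDeriv ν ≤ᵐ[ν] fun _ => ENNReal.ofReal C := by
    refine ae_le_of_forall_setLIntegral_le_of_sigmaFinite hmeas fun s hs _ => ?_
    rw [← withDensity_apply _ hs, hμ, setLIntegral_const]
    simpa using h₁ s
  have hlow : (fun _ => ENNReal.ofReal C⁻¹) ≤ᵐ[ν] μ.rnDeriv ν := by
    refine ae_le_of_forall_setLIntegral_le_of_sigmaFinite measurable_const fun s hs _ => ?_
    rw [← withDensity_apply (μ.rnDeriv ν) hs, hμ, setLIntegral_const,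
      ENNReal.ofReal_inv_of_pos hC0, mul_comm, ← div_eq_mul_inv]
    refine ENNReal.div_le_of_le_mul ?_
    rw [mul_comm]
    simpa using h₂ s
  have hCi : C⁻¹ ≤ C := (inv_le_one_of_one_le₀ hC).trans hC
  -- Truncation changes the derivative only on a null set and makes the bounds hold everywhere.
  refine ⟨fun x => max C⁻¹ (min C (μ.rnDeriv ν x).toReal), by fun_prop,
    fun x => ⟨le_max_left _ _, max_le hCi (min_le_left _ _)⟩, ?_⟩
  conv_lhs => rw [← hμ]
  refine withDensity_congr_ae ?_
  filter_upwards [hup, hlow] with x hx₁ hx₂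
  have hfin : μ.rnDeriv ν x ≠ ∞ := ne_top_of_le_ne_top ENNReal.ofReal_ne_top hx₁
  have h1 : (μ.rnDeriv ν x).toReal ≤ C := ENNReal.toReal_le_of_le_ofReal hC0.le hx₁
  have h2 : C⁻¹ ≤ (μ.rnDeriv ν x).toReal := (ENNReal.ofReal_le_iff_le_toReal hfin).1 hx₂
  rw [min_eq_right h1, max_eq_right h2, ENNReal.ofReal_toReal hfin]

lemma withDensity_compProd_left {X Y : Type*} [MeasurableSpace X] [MeasurableSpace Y]
    (ν : Measure X) [SFinite ν] (κ : Kernel X Y) [IsSFiniteKernel κ] {f : X → ℝ≥0∞}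
    (hf : Measurable f) :
    (ν.withDensity f).compProd κ = (ν.compProd κ).withDensity (fun w => f w.1) := by
  ext s hs
  have hf' : Measurable fun w : X × Y => f w.1 := hf.comp measurable_fst
  rw [withDensity_apply _ hs, ← lintegral_indicator hs, Measure.lintegral_compProd
    (hf'.indicator hs), Measure.compProd_apply hs,
    lintegral_withDensity_eq_lintegral_mul _ hf (Kernel.measurable_kernel_prodMk_left hs)]
  refine lintegral_congr fun a => ?_
  have : (fun b => s.indicator (fun w : X × Y => f w.1) (a, b))
      = (Prod.mk a ⁻¹' s).indicator (fun _ => f a) := by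
    ext b; rfl
  rw [this, lintegral_indicator_const (measurable_prodMk_left hs)]
  rfl

/-! ### Joint law of a history and one private release -/

section Step

variable {H Z : Type*} [MeasurableSpace H] [MeasurableSpace Z] {K : ℕ}

/-- The joint law of a history with law `ν` and the next release, when the sensitive observation
has distribution `p`. -/
noncomputable def mixStep (Q : Kernel (H × Fin K) Z) (ν : Measure H) (p : Fin K → ℝ) :
    Measure (H × Z) :=
  ∑ x, ENNReal.ofReal (p x) • ν.compProd (Q.sectL x)

variable (Q : Kernel (H × Fin K) Z) [IsMarkovKernel Q] (ν : Measure H)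

lemma map_compProd_dataLaw_eq_mixStep [SFinite ν] (p : Fin K → ℝ) :
    ((ν.prod (dataLaw p)).compProd Q).map (fun w : (H × Fin K) × Z => (w.1.1, w.2))
      = mixStep Q ν p := by
  have : SFinite (dataLaw p) := by unfold dataLaw; infer_instance
  have hm : Measurable (fun w : (H × Fin K) × Z => (w.1.1, w.2)) := by fun_prop
  ext s hs
  have hk : Measurable fun a : H × Fin K => Q a (Prod.mk a.1 ⁻¹' s) := by
    have := Kernel.measurable_kernel_prodMk_left (κ := Q) (hm hs)
    exact this
  rw [Measure.map_apply hm hs, Measure.compProd_apply (hm hs)]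
  change ∫⁻ a : H × Fin K, Q a (Prod.mk a.1 ⁻¹' s) ∂(ν.prod (dataLaw p)) = _
  rw [lintegral_prod _ hk.aemeasurable]
  simp only [mixStep, dataLaw, lintegral_finsetSum_measure, lintegral_smul_measure,
    lintegral_dirac, Measure.finsetSum_apply, Measure.smul_apply, smul_eq_mul]
  have hkx : ∀ x : Fin K, Measurable fun h : H => Q (h, x) (Prod.mk h ⁻¹' s) := fun x =>
    hk.comp (measurable_id.prodMk measurable_const)
  rw [lintegral_finsetSum _ fun x _ => (hkx x).const_mul _]
  refine Finset.sum_congr rfl fun x _ => ?_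
  rw [lintegral_const_mul _ (hkx x), Measure.compProd_apply hs]
  rfl

variable {Q ν}

lemma sum_ofReal_eq_one_of_mem_stdSimplex {p : Fin K → ℝ} (hp : p ∈ stdSimplex ℝ (Fin K)) :
    ∑ x, ENNReal.ofReal (p x) = 1 := by
  rw [← ENNReal.ofReal_sum_of_nonneg fun x _ => hp.1 x, hp.2, ENNReal.ofReal_one]

lemma isProbabilityMeasure_mixStep [IsProbabilityMeasure ν] {p : Fin K → ℝ}
    (hp : p ∈ stdSimplex ℝ (Fin K)) : IsProbabilityMeasure (mixStep Q ν p) := by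
  constructor
  simp [mixStep, Measure.finsetSum_apply, sum_ofReal_eq_one_of_mem_stdSimplex hp]

lemma map_fst_mixStep [IsProbabilityMeasure ν] {p : Fin K → ℝ} (hp : p ∈ stdSimplex ℝ (Fin K)) :
    (mixStep Q ν p).map Prod.fst = ν := by
  ext s hs
  have h : ∀ x, (ν.compProd (Q.sectL x)) (Prod.fst ⁻¹' s) = ν s := fun x => by
    rw [← Measure.map_apply measurable_fst hs]
    change (ν.compProd (Q.sectL x)).fst s = ν s
    rw [Measure.fst_compProd]
  rw [Measure.map_apply measurable_fst hs]
  simp [mixStep, Measure.finsetSum_apply, h, ← Finset.sum_mul,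
    sum_ofReal_eq_one_of_mem_stdSimplex hp]

variable {α : ℝ}

/-- The joint laws given the sensitive observation have densities in `[e^{-α}, e^α]` with respect
to any of their mixtures. -/
lemma exists_density_mixStep [IsProbabilityMeasure ν] (hα : 0 ≤ α)
    (hQ : ∀ (h : H) (x x' : Fin K) (A : Set Z), MeasurableSet A →
      Q (h, x) A ≤ ENNReal.ofReal (Real.exp α) * Q (h, x') A)
    {p : Fin K → ℝ} (hp : p ∈ stdSimplex ℝ (Fin K)) :
    ∃ g : Fin K → H × Z → ℝ, (∀ x, Measurable (g x)) ∧
      (∀ x w, Real.exp (-α) ≤ g x w ∧ g x w ≤ Real.exp α) ∧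
      (∀ x, ν.compProd (Q.sectL x)
        = (mixStep Q ν p).withDensity fun w => ENNReal.ofReal (g x w)) ∧
      ∀ᵐ w ∂(mixStep Q ν p), ∑ x, p x * g x w = 1 := by
  have := isProbabilityMeasure_mixStep (Q := Q) (ν := ν) hp
  have hle : ∀ x x', ν.compProd (Q.sectL x)
      ≤ ENNReal.ofReal (Real.exp α) • ν.compProd (Q.sectL x') := by
    intro x x'
    refine Measure.le_iff.2 fun s hs => ?_
    rw [Measure.smul_apply, smul_eq_mul, Measure.compProd_apply hs, Measure.compProd_apply hs,
      ← lintegral_const_mul _ (Kernel.measurable_kernel_prodMk_left hs)]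
    exact lintegral_mono fun h => hQ h x x' _ (measurable_prodMk_left hs)
  have key : ∀ x, ∃ g : H × Z → ℝ, Measurable g ∧
      (∀ w, (Real.exp α)⁻¹ ≤ g w ∧ g w ≤ Real.exp α) ∧
      ν.compProd (Q.sectL x) = (mixStep Q ν p).withDensity fun w => ENNReal.ofReal (g w) := by
    intro x
    refine exists_density_of_le_smul _ _ (Real.one_le_exp hα) ?_ ?_
    · refine Measure.le_iff.2 fun s _ => ?_
      simp only [mixStep, Measure.smul_apply, Measure.finsetSum_apply, smul_eq_mul]
      rw [Finset.mul_sum]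
      calc (ν.compProd (Q.sectL x)) s
          = ∑ y, ENNReal.ofReal (p y) * (ν.compProd (Q.sectL x)) s := by
            rw [← Finset.sum_mul, sum_ofReal_eq_one_of_mem_stdSimplex hp, one_mul]
        _ ≤ _ := Finset.sum_le_sum fun y _ => by
            rw [mul_left_comm]
            gcongr
            exact hle x y s
    · refine Measure.le_iff.2 fun s _ => ?_
      simp only [mixStep, Measure.smul_apply, Measure.finsetSum_apply, smul_eq_mul]
      calc _ ≤ ∑ y, ENNReal.ofReal (p y) * (ENNReal.ofReal (Real.exp α) *
              (ν.compProd (Q.sectL x)) s) := Finset.sum_le_sum fun y _ => by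
            gcongr
            exact hle y x s
        _ = _ := by rw [← Finset.sum_mul, sum_ofReal_eq_one_of_mem_stdSimplex hp, one_mul]
  choose g hg hb hd using key
  refine ⟨g, hg, fun x w => by rw [Real.exp_neg]; exact hb x w, hd, ?_⟩
  have hg0 : ∀ x w, 0 ≤ g x w := fun x w => (by positivity : 0 ≤ (Real.exp α)⁻¹).trans (hb x w).1
  -- The mixture of the densities is a density of the mixture with respect to itself, hence `1`
  -- almost everywhere by uniqueness.
  have h1 : (mixStep Q ν p).withDensity (fun w => ENNReal.ofReal (∑ x, p x * g x w))
      = (mixStep Q ν p).withDensity 1 := by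
    rw [withDensity_one]
    ext s hs
    rw [withDensity_apply _ hs]
    calc ∫⁻ w in s, ENNReal.ofReal (∑ x, p x * g x w) ∂(mixStep Q ν p)
        = ∫⁻ w in s, ∑ x, ENNReal.ofReal (p x) * ENNReal.ofReal (g x w) ∂(mixStep Q ν p) := by
          refine lintegral_congr fun w => ?_
          rw [ENNReal.ofReal_sum_of_nonneg fun x _ => mul_nonneg (hp.1 x) (hg0 x w)]
          exact Finset.sum_congr rfl fun x _ => ENNReal.ofReal_mul (hp.1 x)
      _ = ∑ x, ENNReal.ofReal (p x) * (ν.compProd (Q.sectL x)) s := by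
          rw [lintegral_finsetSum _ fun x _ => (hg x).ennreal_ofReal.const_mul _]
          refine Finset.sum_congr rfl fun x _ => ?_
          rw [lintegral_const_mul _ (hg x).ennreal_ofReal, hd x, withDensity_apply _ hs]
      _ = mixStep Q ν p s := by simp [mixStep, Measure.finsetSum_apply]
  have hme : Measurable fun w => ENNReal.ofReal (∑ x, p x * g x w) :=
    (Finset.measurable_sum _ fun x _ => (hg x).const_mul _).ennreal_ofReal
  have h2 := (withDensity_eq_iff_of_sigmaFinite hme.aemeasurable aemeasurable_const).1 h1
  filter_upwards [h2] with w hw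
  simpa [ENNReal.ofReal_eq_one] using hw

/-- Chain rule for likelihood ratios: the ratio of the histories is multiplied by the conditional
ratio of the new release. -/
lemma mixStep_withDensity [IsProbabilityMeasure ν] {p q : Fin K → ℝ}
    (hq : q ∈ stdSimplex ℝ (Fin K)) {g : Fin K → H × Z → ℝ} (hg : ∀ x, Measurable (g x))
    (hg0 : ∀ x w, 0 ≤ g x w)
    (hd : ∀ x, ν.compProd (Q.sectL x)
        = (mixStep Q ν p).withDensity fun w => ENNReal.ofReal (g x w))
    {L : H → ℝ} (hL : Measurable L) (hL0 : ∀ h, 0 ≤ L h) :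
    mixStep Q (ν.withDensity fun h => ENNReal.ofReal (L h)) q
      = (mixStep Q ν p).withDensity
          fun w => ENNReal.ofReal (L w.1 * ∑ x, q x * g x w) := by
  have hL' : Measurable fun w : H × Z => ENNReal.ofReal (L w.1) :=
    (hL.comp measurable_fst).ennreal_ofReal
  ext s hs
  rw [withDensity_apply _ hs]
  have : ∀ w : H × Z, ENNReal.ofReal (L w.1 * ∑ x, q x * g x w)
      = ∑ x, ENNReal.ofReal (q x) * (ENNReal.ofReal (g x w) * ENNReal.ofReal (L w.1)) := by
    intro w
    rw [Finset.mul_sum, ENNReal.ofReal_sum_of_nonneg fun x _ =>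
      mul_nonneg (hL0 _) (mul_nonneg (hq.1 x) (hg0 x w))]
    refine Finset.sum_congr rfl fun x _ => ?_
    rw [← ENNReal.ofReal_mul (hg0 x w), ← ENNReal.ofReal_mul (hq.1 x)]
    congr 1; ring
  have hgL : ∀ x, Measurable fun w : H × Z =>
      ENNReal.ofReal (g x w) * ENNReal.ofReal (L w.1) := fun x => (hg x).ennreal_ofReal.mul hL'
  simp only [this]
  rw [lintegral_finsetSum _ fun x _ => (hgL x).const_mul _]
  simp only [mixStep, Measure.finsetSum_apply, Measure.smul_apply, smul_eq_mul]
  refine Finset.sum_congr rfl fun x _ => ?_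
  rw [lintegral_const_mul _ (hgL x),
    withDensity_compProd_left _ _ hL.ennreal_ofReal, hd x,
    ← withDensity_mul _ (hg x).ennreal_ofReal hL', withDensity_apply _ hs]
  rfl

end Step

/-! ### Growth of the average relative entropy in one round -/

/-- From `log r ≥ 1 - 1/r` and `1/r ≤ e^α`. For a likelihood ratio `r` the linear term integrates to
zero, which bounds relative entropy by a chi-square term. -/
lemma neg_log_le_of_exp_neg_le {α r : ℝ} (h : Real.exp (-α) ≤ r) :
    -Real.log r ≤ -(r - 1) + Real.exp α * (r - 1) ^ 2 := by
  have hr : 0 < r := (Real.exp_pos _).trans_le h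
  have h1 := Real.one_sub_inv_le_log_of_pos hr
  have h2 : r⁻¹ ≤ Real.exp α := by
    rw [← neg_neg α, Real.exp_neg (-α)]
    exact inv_anti₀ (Real.exp_pos _) h
  have h3 : r⁻¹ * (r - 1) ^ 2 ≤ Real.exp α * (r - 1) ^ 2 := by gcongr
  have h4 : r⁻¹ * (r - 1) ^ 2 = r - 2 + r⁻¹ := by field_simp; ring
  linarith

lemma abs_sub_one_le_exp_sub_one {α t : ℝ} (h₁ : Real.exp (-α) ≤ t) (h₂ : t ≤ Real.exp α) :
    |t - 1| ≤ Real.exp α - 1 := by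
  have := Real.add_one_le_exp α
  have := Real.add_one_le_exp (-α)
  have h : 2 ≤ Real.exp α + Real.exp (-α) := by linarith
  rw [abs_le]
  constructor <;> linarith

/-- A family of perturbations of `p₀` indexed by a finite set `Ω` has mean square variation at most
`v` if the average over `Ω` of the squared effect on every test function bounded by `1` is at most
`v`. -/
def MeanSquareVariationLE {K : ℕ} {Ω : Type*} [Fintype Ω] (p₀ : Fin K → ℝ) (p : Ω → Fin K → ℝ)
    (v : ℝ) : Prop :=
  ∀ a : Fin K → ℝ, (∀ k, |a k| ≤ 1) →
    ∑ ω, (∑ k, (p ω k - p₀ k) * a k) ^ 2 ≤ Fintype.card Ω * v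

section Step

variable {H Z : Type*} [MeasurableSpace H] [MeasurableSpace Z] {K : ℕ}
  {Q : Kernel (H × Fin K) Z} [IsMarkovKernel Q] {ν : Measure H} {α : ℝ}
  {Ω : Type*} [Fintype Ω]

/-- Since `p ω` and `p₀` have equal mass and `t` has `p₀`-mean `1`, each term is the effect of `p ω
- p₀` on `t - 1`, and `(t - 1) / (e^α - 1)` is an admissible test function. -/
lemma MeanSquareVariationLE.sum_sq_sub_one_le {p₀ : Fin K → ℝ} (hp₀ : p₀ ∈ stdSimplex ℝ (Fin K))
    {p : Ω → Fin K → ℝ} (hp : ∀ ω, p ω ∈ stdSimplex ℝ (Fin K)) {v : ℝ}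
    (hv : MeanSquareVariationLE p₀ p v) (hα : 0 < α) {t : Fin K → ℝ}
    (ht : ∀ x, Real.exp (-α) ≤ t x ∧ t x ≤ Real.exp α) (hsum : ∑ x, p₀ x * t x = 1) :
    ∑ ω, (∑ x, p ω x * t x - 1) ^ 2 ≤ Fintype.card Ω * ((Real.exp α - 1) ^ 2 * v) := by
  have hc : 0 < Real.exp α - 1 := by linarith [Real.add_one_le_exp α]
  have h := hv (fun x => (t x - 1) / (Real.exp α - 1)) fun x => by
    rw [abs_div, abs_of_pos hc, div_le_one hc]
    exact abs_sub_one_le_exp_sub_one (ht x).1 (ht x).2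
  have heq : ∀ ω, (∑ x, p ω x * t x - 1)
      = (Real.exp α - 1) * ∑ x, (p ω x - p₀ x) * ((t x - 1) / (Real.exp α - 1)) := by
    intro ω
    calc ∑ x, p ω x * t x - 1
        = (∑ x, p ω x * t x - ∑ x, p₀ x * t x) - (∑ x, p ω x - ∑ x, p₀ x) := by
          rw [hsum, (hp ω).2, hp₀.2]; ring
      _ = ∑ x, (p ω x - p₀ x) * (t x - 1) := by
          rw [← Finset.sum_sub_distrib, ← Finset.sum_sub_distrib, ← Finset.sum_sub_distrib]
          exact Finset.sum_congr rfl fun x _ => by ring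
      _ = _ := by
          rw [Finset.mul_sum]
          refine Finset.sum_congr rfl fun x _ => ?_
          field_simp
  simp only [heq, mul_pow, ← Finset.mul_sum]
  calc _ ≤ (Real.exp α - 1) ^ 2 * (Fintype.card Ω * v) := by gcongr
    _ = _ := by ring

/-- One release: the likelihood ratios with respect to the law under `p₀` are multiplied by bounded
factors, and their average relative entropy grows by at most `e^α (e^α - 1)² v`. -/
lemma exists_likelihood_mixStep [IsProbabilityMeasure ν] (hα : 0 < α)
    (hQ : ∀ (h : H) (x x' : Fin K) (A : Set Z), MeasurableSet A →
      Q (h, x) A ≤ ENNReal.ofReal (Real.exp α) * Q (h, x') A)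
    {p₀ : Fin K → ℝ} (hp₀ : p₀ ∈ stdSimplex ℝ (Fin K))
    {p : Ω → Fin K → ℝ} (hp : ∀ ω, p ω ∈ stdSimplex ℝ (Fin K)) {v : ℝ}
    (hv : MeanSquareVariationLE p₀ p v)
    {B : ℝ} {L : Ω → H → ℝ} (hL : ∀ ω, Measurable (L ω))
    (hLB : ∀ ω h, Real.exp (-B) ≤ L ω h ∧ L ω h ≤ Real.exp B) :
    ∃ L' : Ω → H × Z → ℝ, (∀ ω, Measurable (L' ω)) ∧
      (∀ ω w, Real.exp (-(B + α)) ≤ L' ω w ∧ L' ω w ≤ Real.exp (B + α)) ∧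
      (∀ ω, mixStep Q (ν.withDensity fun h => ENNReal.ofReal (L ω h)) (p ω)
        = (mixStep Q ν p₀).withDensity fun w => ENNReal.ofReal (L' ω w)) ∧
      ∑ ω, ∫ w, -Real.log (L' ω w) ∂(mixStep Q ν p₀)
        ≤ ∑ ω, ∫ h, -Real.log (L ω h) ∂ν
          + Fintype.card Ω * (Real.exp α * (Real.exp α - 1) ^ 2 * v) := by
  obtain ⟨g, hg, hgb, hgd, hg1⟩ := exists_density_mixStep (ν := ν) hα.le hQ hp₀
  have hP := isProbabilityMeasure_mixStep (Q := Q) (ν := ν) hp₀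
  have hg0 : ∀ x w, 0 ≤ g x w := fun x w => (Real.exp_pos _).le.trans (hgb x w).1
  have hL0 : ∀ ω h, 0 < L ω h := fun ω h => (Real.exp_pos _).trans_le (hLB ω h).1
  set r : Ω → H × Z → ℝ := fun ω w => ∑ x, p ω x * g x w 
  have hrm : ∀ ω, Measurable (r ω) := fun ω =>
    Finset.measurable_sum _ fun x _ => (hg x).const_mul _
  have hrb : ∀ ω w, Real.exp (-α) ≤ r ω w ∧ r ω w ≤ Real.exp α := by
    intro ω w
    have hc : ∀ c : ℝ, c = ∑ x, p ω x * c := fun c => by rw [← Finset.sum_mul, (hp ω).2, one_mul]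
    constructor
    · rw [hc (Real.exp (-α))]
      exact Finset.sum_le_sum fun x _ => mul_le_mul_of_nonneg_left (hgb x w).1 ((hp ω).1 x)
    · rw [hc (Real.exp α)]
      exact Finset.sum_le_sum fun x _ => mul_le_mul_of_nonneg_left (hgb x w).2 ((hp ω).1 x)
  have hr0 : ∀ ω w, 0 < r ω w := fun ω w => (Real.exp_pos _).trans_le (hrb ω w).1
  have hrint : ∀ ω, Integrable (r ω) (mixStep Q ν p₀) := fun ω =>
    Integrable.of_bound (hrm ω).aestronglyMeasurable (Real.exp α)
      (Filter.Eventually.of_forall fun w => by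
        rw [Real.norm_of_nonneg (hr0 ω w).le]; exact (hrb ω w).2)
  have hr1 : ∀ ω, ∫ w, r ω w ∂(mixStep Q ν p₀) = 1 := by
    intro ω
    have h := mixStep_withDensity (Q := Q) (ν := ν) (p := p₀) (hp ω) hg hg0 hgd
      (L := fun _ => 1) measurable_const fun _ => zero_le_one
    simp only [ENNReal.ofReal_one, one_mul] at h
    rw [show (fun _ : H => (1 : ℝ≥0∞)) = 1 from rfl, withDensity_one] at h
    have h2 := (isProbabilityMeasure_mixStep (Q := Q) (ν := ν) (hp ω)).measure_univ
    rw [h, withDensity_apply _ MeasurableSet.univ, Measure.restrict_univ] at h2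
    rw [integral_eq_lintegral_of_nonneg_ae (Filter.Eventually.of_forall fun w => (hr0 ω w).le)
      (hrm ω).aestronglyMeasurable, h2, ENNReal.toReal_one]
  have hsqint : ∀ ω, Integrable (fun w => (r ω w - 1) ^ 2) (mixStep Q ν p₀) := fun ω =>
    Integrable.of_bound (((hrm ω).sub_const 1).pow_const 2).aestronglyMeasurable
      ((Real.exp α - 1) ^ 2) (Filter.Eventually.of_forall fun w => by
        rw [Real.norm_of_nonneg (sq_nonneg _), ← sq_abs]
        have := abs_sub_one_le_exp_sub_one (hrb ω w).1 (hrb ω w).2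
        gcongr)
  have hlogLint : ∀ ω, Integrable (fun h => -Real.log (L ω h)) ν := fun ω =>
    Integrable.of_bound ((hL ω).log.neg).aestronglyMeasurable B
      (Filter.Eventually.of_forall fun h => by
        rw [norm_neg, Real.norm_eq_abs, abs_le]
        exact ⟨(Real.le_log_iff_exp_le (hL0 ω h)).2 (hLB ω h).1,
          (Real.log_le_iff_le_exp (hL0 ω h)).2 (hLB ω h).2⟩)
  have hlogrint : ∀ ω, Integrable (fun w => -Real.log (r ω w)) (mixStep Q ν p₀) := fun ω =>
    Integrable.of_bound ((hrm ω).log.neg).aestronglyMeasurable α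
      (Filter.Eventually.of_forall fun w => by
        rw [norm_neg, Real.norm_eq_abs, abs_le]
        exact ⟨(Real.le_log_iff_exp_le (hr0 ω w)).2 (hrb ω w).1,
          (Real.log_le_iff_le_exp (hr0 ω w)).2 (hrb ω w).2⟩)
  -- The release leaves the history marginal unchanged, so the entropy already accumulated carries
  -- over exactly.
  have hmap : (mixStep Q ν p₀).map Prod.fst = ν := map_fst_mixStep hp₀
  have hlogLint' : ∀ ω, Integrable (fun w : H × Z => -Real.log (L ω w.1)) (mixStep Q ν p₀) :=
    fun ω => by
      have := hlogLint ω
      rw [← hmap] at this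
      exact this.comp_measurable measurable_fst
  have hlogLeq : ∀ ω, ∫ w, -Real.log (L ω w.1) ∂(mixStep Q ν p₀) = ∫ h, -Real.log (L ω h) ∂ν :=
    fun ω => by
      conv_rhs => rw [← hmap]
      exact (integral_map measurable_fst.aemeasurable
        ((hL ω).log.neg).aestronglyMeasurable).symm
  refine ⟨fun ω w => L ω w.1 * r ω w, fun ω => ((hL ω).comp measurable_fst).mul (hrm ω),
    fun ω w => ⟨?_, ?_⟩, fun ω => mixStep_withDensity (hp ω) hg hg0 hgd (hL ω)
      fun h => (hL0 ω h).le, ?_⟩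
  · rw [neg_add, Real.exp_add]
    exact mul_le_mul (hLB ω _).1 (hrb ω w).1 (Real.exp_pos _).le (hL0 ω _).le
  · rw [Real.exp_add]
    exact mul_le_mul (hLB ω _).2 (hrb ω w).2 (hr0 ω w).le (Real.exp_pos _).le
  · have hstep : ∀ ω, ∫ w, -Real.log (L ω w.1 * r ω w) ∂(mixStep Q ν p₀)
        ≤ ∫ h, -Real.log (L ω h) ∂ν
          + Real.exp α * ∫ w, (r ω w - 1) ^ 2 ∂(mixStep Q ν p₀) := by
      intro ω
      have h1 : ∫ w, -Real.log (L ω w.1 * r ω w) ∂(mixStep Q ν p₀)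
          = ∫ h, -Real.log (L ω h) ∂ν + ∫ w, -Real.log (r ω w) ∂(mixStep Q ν p₀) := by
        rw [← hlogLeq, ← integral_add (hlogLint' ω) (hlogrint ω)]
        refine integral_congr_ae (Filter.Eventually.of_forall fun w => ?_)
        simp only
        rw [Real.log_mul (hL0 ω _).ne' (hr0 ω w).ne']
        ring
      have hi1 : Integrable (fun w => -(r ω w - 1)) (mixStep Q ν p₀) :=
        ((hrint ω).sub (integrable_const 1)).neg
      have hi2 := (hsqint ω).const_mul (Real.exp α)
      have h2 : ∫ w, -Real.log (r ω w) ∂(mixStep Q ν p₀)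
          ≤ ∫ w, (-(r ω w - 1) + Real.exp α * (r ω w - 1) ^ 2) ∂(mixStep Q ν p₀) :=
        integral_mono (hlogrint ω) (hi1.add hi2) fun w => neg_log_le_of_exp_neg_le (hrb ω w).1
      have h3 : ∫ w, -(r ω w - 1) ∂(mixStep Q ν p₀) = 0 := by
        rw [integral_neg, integral_sub (hrint ω) (integrable_const 1), hr1]
        simp
      rw [integral_add hi1 hi2, h3, zero_add, integral_const_mul] at h2
      rw [h1]
      gcongr
    refine (Finset.sum_le_sum fun ω _ => hstep ω).trans ?_
    rw [Finset.sum_add_distrib, ← Finset.mul_sum, ← integral_finsetSum _ fun ω _ => hsqint ω]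
    -- The sum over `ω` must be taken under the integral: at fixed `w` the test function `g · w` is
    -- the same for all `ω`, and only the average over `ω` is controlled.
    have h3 : ∫ w, ∑ ω, (r ω w - 1) ^ 2 ∂(mixStep Q ν p₀)
        ≤ ∫ _, Fintype.card Ω * ((Real.exp α - 1) ^ 2 * v) ∂(mixStep Q ν p₀) := by
      refine integral_mono_ae (integrable_finsetSum _ fun ω _ => hsqint ω)
        (integrable_const _) ?_
      filter_upwards [hg1] with w hw
      exact hv.sum_sq_sub_one_le hp₀ hp hα (fun x => hgb x w) hw
    rw [integral_const, probReal_univ, one_smul] at h3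
    have h4 := mul_le_mul_of_nonneg_left h3 (Real.exp_pos α).le
    linarith

end Step

/-! ### Likelihood ratios of the whole released sample -/

section Law

variable {K n : ℕ} {α : ℝ} (M : Mechanism.{u} K n α)

lemma Mechanism.law_succ_eq_mixStep (p : Fin K → ℝ) (i : ℕ) [SFinite (M.law p i)] :
    M.law p (i + 1) = mixStep (M.Q i) (M.law p i) p :=
  map_compProd_dataLaw_eq_mixStep (M.Q i) (M.law p i) p

lemma Mechanism.isProbabilityMeasure_law {p : Fin K → ℝ} (hp : p ∈ stdSimplex ℝ (Fin K))
    (i : ℕ) : IsProbabilityMeasure (M.law p i) := by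
  induction i with
  | zero => exact Measure.dirac.isProbabilityMeasure
  | succ i ih =>
    rw [M.law_succ_eq_mixStep p i]
    exact isProbabilityMeasure_mixStep hp

variable {Ω : Type*} [Fintype Ω]

/-- Relative entropies add up along the rounds, and the cost of a round does not depend on the law
of the history. The bounds `e^{±iα}` keep the logarithms integrable. -/
lemma Mechanism.exists_likelihood (hα : 0 < α)
    {p₀ : Fin K → ℝ} (hp₀ : p₀ ∈ stdSimplex ℝ (Fin K))
    {p : Ω → Fin K → ℝ} (hp : ∀ ω, p ω ∈ stdSimplex ℝ (Fin K)) {v : ℝ}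
    (hv : MeanSquareVariationLE p₀ p v) (i : ℕ) (hi : i ≤ n) :
    ∃ L : Ω → Hist M.Z i → ℝ, (∀ ω, Measurable (L ω)) ∧
      (∀ ω h, Real.exp (-(i * α)) ≤ L ω h ∧ L ω h ≤ Real.exp (i * α)) ∧
      (∀ ω, M.law (p ω) i = (M.law p₀ i).withDensity fun h => ENNReal.ofReal (L ω h)) ∧
      ∑ ω, ∫ h, -Real.log (L ω h) ∂(M.law p₀ i)
        ≤ Fintype.card Ω * (i * (Real.exp α * (Real.exp α - 1) ^ 2 * v)) := by
  induction i with
  | zero =>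
    refine ⟨fun _ _ => 1, fun _ => measurable_const, by simp, fun ω => ?_, by simp⟩
    simp only [ENNReal.ofReal_one]
    exact (withDensity_one).symm
  | succ i ih =>
    obtain ⟨L, hL, hLB, hLd, hLs⟩ := ih (by omega)
    have h₀ := M.isProbabilityMeasure_law hp₀ i
    have hω := fun ω => M.isProbabilityMeasure_law (hp ω) i
    obtain ⟨L', hL', hLB', hLd', hLs'⟩ := exists_likelihood_mixStep (Q := M.Q i)
      (ν := M.law p₀ i) hα (M.ldp i (by omega)) hp₀ hp hv hL hLB
    refine ⟨L', hL', fun ω w => ?_, fun ω => ?_, ?_⟩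
    · have h := hLB' ω w
      rw [show (i : ℝ) * α + α = ((i + 1 : ℕ) : ℝ) * α by push_cast; ring] at h
      exact h
    · rw [M.law_succ_eq_mixStep p₀ i, M.law_succ_eq_mixStep (p ω) i, hLd ω]
      exact hLd' ω
    · rw [M.law_succ_eq_mixStep p₀ i]
      refine hLs'.trans ?_
      push_cast
      linarith

end Law

/-! ### From relative entropy to the minimax risk -/

/-- The two-point bound on the sum of two quadratic losses, in the form of Bretagnolle and Huber. -/
lemma sq_div_four_mul_one_sub_le_lintegral_add {X : Type*} [MeasurableSpace X] (P : Measure X)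
    [IsProbabilityMeasure P] {L : X → ℝ} (hL : Measurable L) {B : ℝ}
    (hLB : ∀ x, Real.exp (-B) ≤ L x ∧ L x ≤ Real.exp B)
    (hL1 : IsProbabilityMeasure (P.withDensity fun x => ENNReal.ofReal (L x)))
    {f : X → ℝ} (hf : Measurable f) (a b : ℝ) :
    ENNReal.ofReal ((a - b) ^ 2 / 4 * (1 - ∫ x, -Real.log (L x) ∂P))
      ≤ ∫⁻ x, ENNReal.ofReal ((f x - a) ^ 2) ∂P
        + ∫⁻ x, ENNReal.ofReal ((f x - b) ^ 2) ∂(P.withDensity fun x => ENNReal.ofReal (L x)) := by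
  have hL0 : ∀ x, 0 < L x := fun x => (Real.exp_pos _).trans_le (hLB x).1
  have hLint : Integrable L P := Integrable.of_bound hL.aestronglyMeasurable (Real.exp B)
    (Filter.Eventually.of_forall fun x => by
      rw [Real.norm_of_nonneg (hL0 x).le]; exact (hLB x).2)
  have hlogint : Integrable (fun x => -Real.log (L x)) P :=
    Integrable.of_bound (hL.log.neg).aestronglyMeasurable B
      (Filter.Eventually.of_forall fun x => by
        rw [norm_neg, Real.norm_eq_abs, abs_le]
        exact ⟨(Real.le_log_iff_exp_le (hL0 x)).2 (hLB x).1,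
          (Real.log_le_iff_le_exp (hL0 x)).2 (hLB x).2⟩)
  have hint1 : ∫ x, L x ∂P = 1 := by
    have h2 := hL1.measure_univ
    rw [withDensity_apply _ MeasurableSet.univ, Measure.restrict_univ] at h2
    rw [integral_eq_lintegral_of_nonneg_ae (Filter.Eventually.of_forall fun x => (hL0 x).le)
      hL.aestronglyMeasurable, h2, ENNReal.toReal_one]
  -- The left side is chosen so that its mean at `l = L` is `1` minus the relative entropy. The
  -- tangents to `log` at `2` and at `1/2` settle the two cases.
  have hpt : ∀ l : ℝ, 0 < l → 2 + Real.log l - (1 + l) / 2 ≤ 2 * min 1 l := by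
    intro l hl
    rcases le_total 1 l with h | h
    · rw [min_eq_left h]
      have := Real.log_le_sub_one_of_pos (by positivity : 0 < l / 2)
      rw [Real.log_div hl.ne' two_ne_zero] at this
      linarith [Real.log_two_lt_d9]
    · rw [min_eq_right h]
      have := Real.log_le_sub_one_of_pos (by positivity : 0 < l * 2)
      rw [Real.log_mul hl.ne' two_ne_zero] at this
      linarith [Real.log_two_gt_d9]
  -- Both weights `1` and `L` are at least their minimum, and `(f - a)² + (f - b)² ≥ (a - b)² / 2`.
  have hmin : ∀ x, (a - b) ^ 2 / 2 * min 1 (L x) ≤ (f x - a) ^ 2 + L x * (f x - b) ^ 2 := by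
    intro x
    have h0 : 0 ≤ min 1 (L x) := le_min zero_le_one (hL0 x).le
    have h1 : min 1 (L x) * (f x - a) ^ 2 ≤ 1 * (f x - a) ^ 2 := by gcongr; exact min_le_left _ _
    have h2 : min 1 (L x) * (f x - b) ^ 2 ≤ L x * (f x - b) ^ 2 := by
      gcongr; exact min_le_right _ _
    have h3 : 0 ≤ min 1 (L x) * ((f x - a) + (f x - b)) ^ 2 := by positivity
    nlinarith
  have hm' : Measurable fun x => ENNReal.ofReal ((f x - a) ^ 2) :=
    ((hf.sub_const a).pow_const 2).ennreal_ofReal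
  rw [lintegral_withDensity_eq_lintegral_mul _ hL.ennreal_ofReal
    ((hf.sub_const b).pow_const 2).ennreal_ofReal, ← lintegral_add_left hm']
  have hint : ∫ x, (a - b) ^ 2 / 4 * (2 + Real.log (L x) - (1 + L x) / 2) ∂P
      = (a - b) ^ 2 / 4 * (1 - ∫ x, -Real.log (L x) ∂P) := by
    rw [integral_const_mul]
    congr 1
    have : (fun x => 2 + Real.log (L x) - (1 + L x) / 2)
        = fun x => ((3 / 2 : ℝ) - (-Real.log (L x))) - (1 / 2) * L x := by
      ext x; ring
    have hi : Integrable (fun x => (3 / 2 : ℝ) - (-Real.log (L x))) P :=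
      (integrable_const _).sub hlogint
    rw [this, integral_sub hi (hLint.const_mul _), integral_sub (integrable_const _) hlogint,
      integral_const_mul, hint1, integral_const, probReal_univ]
    simp only [smul_eq_mul]
    ring
  rw [← hint]
  have hi : Integrable (fun x => (a - b) ^ 2 / 4 * (2 + Real.log (L x) - (1 + L x) / 2)) P :=
    (((integrable_const 2).add (by simpa using hlogint.neg)).sub
      (((integrable_const 1).add hLint).div_const 2)).const_mul _
  have hle : ∫ x, (a - b) ^ 2 / 4 * (2 + Real.log (L x) - (1 + L x) / 2) ∂P
      ≤ (∫⁻ x, ENNReal.ofReal ((a - b) ^ 2 / 4 * (2 + Real.log (L x) - (1 + L x) / 2)) ∂P).toReal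
      := by
    rw [integral_eq_lintegral_pos_part_sub_lintegral_neg_part hi]
    exact sub_le_self _ ENNReal.toReal_nonneg
  refine (ENNReal.ofReal_le_ofReal hle).trans (ENNReal.ofReal_toReal_le.trans ?_)
  refine lintegral_mono fun x => ?_
  rw [Pi.mul_apply, ← ENNReal.ofReal_mul (hL0 x).le,
    ← ENNReal.ofReal_add (sq_nonneg _) (mul_nonneg (hL0 x).le (sq_nonneg _))]
  refine ENNReal.ofReal_le_ofReal (le_trans ?_ (hmin x))
  calc (a - b) ^ 2 / 4 * (2 + Real.log (L x) - (1 + L x) / 2)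
      ≤ (a - b) ^ 2 / 4 * (2 * min 1 (L x)) := by
        have := hpt _ (hL0 x)
        gcongr
    _ = _ := by ring

/-- A lower bound on the minimax risk from a family of perturbations of `p₀`: the functional
differs by at least `Δ` from its value at `p₀`, and the mean square variation is small. -/
lemma ofReal_le_minimaxRisk {K n : ℕ} {α γ : ℝ} (hα : 0 < α) {Ω : Type*} [Fintype Ω] [Nonempty Ω]
    {p₀ : Fin K → ℝ} (hp₀ : p₀ ∈ stdSimplex ℝ (Fin K))
    {p : Ω → Fin K → ℝ} (hp : ∀ ω, p ω ∈ stdSimplex ℝ (Fin K)) {v : ℝ}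
    (hv : MeanSquareVariationLE p₀ p v)
    (hn : n * (Real.exp α * (Real.exp α - 1) ^ 2 * v) ≤ 1 / 2) {Δ : ℝ}
    (hΔ : ∀ ω, Δ ≤ (powerSum γ p₀ - powerSum γ (p ω)) ^ 2) :
    ENNReal.ofReal (Δ / 16) ≤ minimaxRisk.{u} γ K n α := by
  refine le_iInf fun M => le_iInf fun F => ?_
  obtain ⟨L, hL, hLB, hLd, hLs⟩ := M.exists_likelihood hα hp₀ hp hv n le_rfl
  have hcard : (0 : ℝ) < Fintype.card Ω := by exact_mod_cast Fintype.card_pos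
  -- The average entropy is at most `1/2`, so some `ω` attains this bound; it is chosen after the
  -- mechanism.
  obtain ⟨ω, -, hω⟩ := Finset.exists_le_of_sum_le (s := (Finset.univ : Finset Ω))
    Finset.univ_nonempty (f := fun ω => ∫ h, -Real.log (L ω h) ∂(M.law p₀ n))
    (g := fun _ => (1 / 2 : ℝ)) (by
      refine hLs.trans ?_
      rw [Finset.sum_const, Finset.card_univ, nsmul_eq_mul]
      gcongr)
  have h₀ := M.isProbabilityMeasure_law hp₀ n
  have h₁ := M.isProbabilityMeasure_law (hp ω) n
  rw [hLd ω] at h₁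
  have h := sq_div_four_mul_one_sub_le_lintegral_add (M.law p₀ n) (hL ω) (hLB ω) h₁ F.2
    (powerSum γ p₀) (powerSum γ (p ω))
  rw [← hLd ω] at h
  change _ ≤ M.risk F γ p₀ + M.risk F γ (p ω) at h
  set R := ⨆ p ∈ stdSimplex ℝ (Fin K), M.risk F γ p with hR
  have hR₀ : M.risk F γ p₀ ≤ R := le_iSup₂ (f := fun p _ => M.risk F γ p) p₀ hp₀
  have hR₁ : M.risk F γ (p ω) ≤ R := le_iSup₂ (f := fun p _ => M.risk F γ p) (p ω) (hp ω)
  -- Here `2 (Δ / 16) = (Δ / 4) (1 - 1/2)`.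
  have h2 : ENNReal.ofReal (2 * (Δ / 16)) ≤ 2 * R := by
    rw [two_mul R]
    refine le_trans (ENNReal.ofReal_le_ofReal ?_) (h.trans (add_le_add hR₀ hR₁))
    have h3 := mul_le_mul_of_nonneg_left (sub_le_sub_left hω 1)
      (sq_nonneg (powerSum γ p₀ - powerSum γ (p ω)))
    have h4 := hΔ ω
    linarith
  rw [ENNReal.ofReal_mul two_pos.le, ENNReal.ofReal_ofNat] at h2
  exact (ENNReal.mul_le_mul_iff_right two_ne_zero ENNReal.ofNat_ne_top).1 h2

/-! ### Comparison with the privacy factor -/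

lemma exp_mul_sq_le_privacyFactor {α : ℝ} (hα : 0 < α) (hα1 : α < 1) :
    Real.exp α * (Real.exp α - 1) ^ 2 ≤ 3 * privacyFactor α := by
  have h1 : Real.exp α ≤ 3 :=
    (Real.exp_le_exp.2 hα1.le).trans (by linarith [Real.exp_one_lt_d9])
  have h2 : Real.exp α ≤ Real.exp (2 * α) := Real.exp_le_exp.2 (by linarith)
  have h3 : Real.exp (-2 * α) ≤ 1 := Real.exp_le_one_iff.2 (by linarith)
  have h4 : 0 ≤ Real.exp α - 1 := by linarith [Real.add_one_le_exp α]
  have h5 : Real.exp α - 1 ≤ Real.exp (2 * α) - Real.exp (-2 * α) := by linarith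
  unfold privacyFactor
  gcongr

lemma sixteen_mul_sq_le_privacyFactor {α : ℝ} (hα : 0 < α) : 16 * α ^ 2 ≤ privacyFactor α := by
  have h1 : 2 * α ≤ Real.sinh (2 * α) := Real.self_le_sinh_iff.2 (by linarith)
  rw [Real.sinh_eq] at h1
  have h2 : 4 * α ≤ Real.exp (2 * α) - Real.exp (-2 * α) := by
    rw [neg_mul]; linarith
  unfold privacyFactor
  calc 16 * α ^ 2 = (4 * α) ^ 2 := by ring
    _ ≤ _ := by gcongr

lemma MeanSquareVariationLE.ofReal_le_minimaxRisk {K n : ℕ} {α γ : ℝ} (hα : 0 < α) (hα1 : α < 1)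
    {Ω : Type*} [Fintype Ω] [Nonempty Ω]
    {p₀ : Fin K → ℝ} (hp₀ : p₀ ∈ stdSimplex ℝ (Fin K))
    {p : Ω → Fin K → ℝ} (hp : ∀ ω, p ω ∈ stdSimplex ℝ (Fin K)) {v : ℝ} (hv0 : 0 ≤ v)
    (hv : MeanSquareVariationLE p₀ p v) (hn : n * privacyFactor α * v ≤ 1 / 6) {Δ : ℝ}
    (hΔ : ∀ ω, Δ ≤ (powerSum γ p₀ - powerSum γ (p ω)) ^ 2) :
    ENNReal.ofReal (Δ / 16) ≤ minimaxRisk.{u} γ K n α := by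
  refine LDP.ofReal_le_minimaxRisk hα hp₀ hp hv ?_ hΔ
  have := exp_mul_sq_le_privacyFactor hα hα1
  calc n * (Real.exp α * (Real.exp α - 1) ^ 2 * v) ≤ n * (3 * privacyFactor α * v) := by gcongr
    _ ≤ 1 / 2 := by linarith

/-! ### The two families of hypotheses -/

/-- Cells of mass zero contribute nothing, so masses, test functions and power sums can all be
computed on the few cells in use. -/
lemma sum_extend_eq {ι κ : Type*} [Fintype ι] [Fintype κ] (e : ι ↪ κ) (q : ι → ℝ)
    (G : κ → ℝ → ℝ) (hG : ∀ k, G k 0 = 0) :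
    ∑ k, G k (Function.extend e q 0 k) = ∑ i, G (e i) (q i) := by
  symm
  refine Finset.sum_of_injOn e e.injective.injOn (by simp) (fun k _ hk => ?_) fun i _ => ?_
  · rw [Function.extend_apply' _ _ _ (by simpa using hk)]
    exact hG k
  · rw [e.injective.extend_apply]

/-- The squares of signed sums, summed over all choices of signs. -/
lemma sum_sq_sum_sign_mul {ι : Type*} [Fintype ι] [DecidableEq ι] (b : ι → ℝ) :
    ∑ ε : ι → Bool, (∑ i, (if ε i then 1 else -1) * b i) ^ 2
      = Fintype.card (ι → Bool) * ∑ i, b i ^ 2 := by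
  have hcross : ∀ i j, i ≠ j →
      ∑ ε : ι → Bool, (if ε i then (1 : ℝ) else -1) * (if ε j then 1 else -1) = 0 := by
    intro i j hij
    -- Flipping the sign `i` alone permutes the sign choices and negates the cross term.
    have hinv : Function.Involutive fun ε : ι → Bool => Function.update ε i (!ε i) := by
      intro ε; simp
    have h := Equiv.sum_comp (hinv.toPerm _)
      fun ε : ι → Bool => (if ε i then (1 : ℝ) else -1) * (if ε j then 1 else -1)
    have h' : ∀ ε : ι → Bool, (if (hinv.toPerm _ ε) i then (1 : ℝ) else -1) *
        (if (hinv.toPerm _ ε) j then 1 else -1)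
        = -((if ε i then (1 : ℝ) else -1) * (if ε j then 1 else -1)) := by
      intro ε
      simp only [Function.Involutive.coe_toPerm, Function.update_self,
        Function.update_of_ne hij.symm]
      cases ε i <;> cases ε j <;> simp
    simp only [h', Finset.sum_neg_distrib] at h
    linarith
  have hsq : ∀ ε : ι → Bool, (∑ i, (if ε i then 1 else -1) * b i) ^ 2
      = ∑ i, ∑ j, (b i * b j) * ((if ε i then (1 : ℝ) else -1) * (if ε j then 1 else -1)) := by
    intro ε
    rw [sq, Finset.sum_mul_sum]
    exact Finset.sum_congr rfl fun i _ => Finset.sum_congr rfl fun j _ => by ring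
  simp only [hsq]
  rw [Finset.sum_comm, Finset.mul_sum]
  refine Finset.sum_congr rfl fun i _ => ?_
  rw [Finset.sum_comm, Finset.sum_eq_single i]
  · have h1 : ∀ ε : ι → Bool, (if ε i then (1 : ℝ) else -1) * (if ε i then 1 else -1) = 1 := by
      intro ε; cases ε i <;> simp
    simp only [h1, Finset.sum_const, Finset.card_univ, nsmul_eq_mul, mul_one]
    ring
  · intro j _ hj
    rw [← Finset.mul_sum, hcross i j hj.symm, mul_zero]
  · simp

/-- `m` pairs of cells, of mass `δ` each, and one cell with the remaining mass; for each pair the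
mass is moved to one of its two cells. -/
lemma ofReal_pairs_le_minimaxRisk {K n m : ℕ} {α γ δ : ℝ} (hγ : 0 < γ) (hα : 0 < α)
    (hα1 : α < 1) (hm : 2 * m < K) (hδ : 0 ≤ δ) (hmδ : 2 * m * δ ≤ 1)
    (hn : n * privacyFactor α * (4 * m * δ ^ 2) ≤ 1 / 6) :
    ENNReal.ofReal ((m * (δ ^ γ * (2 ^ γ - 2))) ^ 2 / 16) ≤ minimaxRisk.{u} γ K n α := by
  -- `none` is the cell with the remaining mass, whence the strict inequality `2 * m < K`.
  obtain ⟨e⟩ : Nonempty (Option (Fin m × Bool) ↪ Fin K) :=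
    Function.Embedding.nonempty_of_card_le (by simp; omega)
  let rest : ℝ := 1 - 2 * m * δ
  let q₀ : Option (Fin m × Bool) → ℝ := fun o => o.elim rest fun _ => δ
  let q : (Fin m → Bool) → Option (Fin m × Bool) → ℝ := fun ε o =>
    o.elim rest fun jb => if ε jb.1 = jb.2 then 2 * δ else 0
  have hrest : 0 ≤ rest := by simp only [rest]; linarith
  have hq₀ : ∀ o, 0 ≤ q₀ o := by
    rintro (_ | _)
    · exact hrest
    · exact hδ
  have hq : ∀ ε o, 0 ≤ q ε o := by
    rintro ε (_ | ⟨j, b⟩)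
    · exact hrest
    · simp only [q, Option.elim]
      split_ifs
      · linarith
      · exact le_rfl
  have hext : ∀ r : Option (Fin m × Bool) → ℝ, (∀ o, 0 ≤ r o) →
      ∀ k, 0 ≤ Function.extend e r 0 k := by
    intro r hr k
    by_cases h : ∃ o, e o = k
    · obtain ⟨o, rfl⟩ := h
      rw [e.injective.extend_apply]
      exact hr o
    · rw [Function.extend_apply' _ _ _ h]
      exact le_rfl
  have hsum₀ : ∀ f : Option (Fin m × Bool) → ℝ → ℝ, ∑ o, f o (q₀ o)
      = f none rest + ∑ j, (f (some (j, true)) δ + f (some (j, false)) δ) := by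
    intro f
    simp [Fintype.sum_option, Fintype.sum_prod_type, q₀]
  have hsum : ∀ (f : Option (Fin m × Bool) → ℝ → ℝ) ε, ∑ o, f o (q ε o)
      = f none rest + ∑ j, (f (some (j, true)) (if ε j then 2 * δ else 0)
        + f (some (j, false)) (if ε j then 0 else 2 * δ)) := by
    intro f ε
    simp only [Fintype.sum_option, Fintype.sum_prod_type, q, Option.elim, Fintype.sum_bool]
    congr 1
    refine Finset.sum_congr rfl fun j _ => ?_
    cases ε j <;> simp
  refine MeanSquareVariationLE.ofReal_le_minimaxRisk (Ω := Fin m → Bool)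
    (p₀ := Function.extend e q₀ 0) (p := fun ε => Function.extend e (q ε) 0) hα hα1
    ⟨hext _ hq₀, ?_⟩ (fun ε => ⟨hext _ (hq ε), ?_⟩) (by positivity) ?_ hn fun ε => le_of_eq ?_
  · rw [sum_extend_eq e q₀ (fun _ t => t) fun _ => rfl, hsum₀ fun _ t => t]
    simp [rest]
    ring
  · rw [sum_extend_eq e (q ε) (fun _ t => t) fun _ => rfl, hsum fun _ t => t]
    have : ∀ j, (if ε j then 2 * δ else 0) + (if ε j then 0 else 2 * δ) = 2 * δ := by
      intro j; cases ε j <;> simp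
    simp [this, rest]
    ring
  · intro a ha
    have hd : ∀ ε, ∑ k, (Function.extend e (q ε) 0 k - Function.extend e q₀ 0 k) * a k
        = ∑ j, (if ε j then 1 else -1) *
          (δ * (a (e (some (j, true))) - a (e (some (j, false))))) := by
      intro ε
      simp only [sub_mul, Finset.sum_sub_distrib]
      rw [sum_extend_eq e q₀ (fun k t => t * a k) fun _ => zero_mul _,
        sum_extend_eq e (q ε) (fun k t => t * a k) fun _ => zero_mul _,
        hsum₀ fun o t => t * a (e o), hsum fun o t => t * a (e o), add_sub_add_left_eq_sub,
        ← Finset.sum_sub_distrib]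
      refine Finset.sum_congr rfl fun j _ => ?_
      cases ε j <;> simp <;> ring
    simp only [hd]
    rw [sum_sq_sum_sign_mul]
    gcongr
    calc ∑ j, (δ * (a (e (some (j, true))) - a (e (some (j, false))))) ^ 2
        ≤ ∑ _j : Fin m, 4 * δ ^ 2 := Finset.sum_le_sum fun j _ => by
          rw [mul_pow, mul_comm]
          have h1 := abs_le.1 (ha (e (some (j, true))))
          have h2 := abs_le.1 (ha (e (some (j, false))))
          have : (a (e (some (j, true))) - a (e (some (j, false)))) ^ 2 ≤ 2 ^ 2 :=
            sq_le_sq' (by linarith) (by linarith)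
          nlinarith [sq_nonneg δ]
      _ = 4 * m * δ ^ 2 := by simp; ring
  · have h0 : (0 : ℝ) ^ γ = 0 := Real.zero_rpow hγ.ne'
    unfold powerSum
    rw [sum_extend_eq e q₀ (fun _ t => t ^ γ) fun _ => h0,
      sum_extend_eq e (q ε) (fun _ t => t ^ γ) fun _ => h0,
      hsum₀ fun _ t => t ^ γ, hsum fun _ t => t ^ γ]
    -- The contribution of a pair is independent of its sign, so the changes accumulate linearly in
    -- `m`.
    have : ∀ j, (if ε j then 2 * δ else 0) ^ γ + (if ε j then 0 else 2 * δ) ^ γ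
        = 2 ^ γ * δ ^ γ := by
      intro j
      cases ε j <;> simp [h0, Real.mul_rpow two_pos.le hδ]
    simp only [this, Finset.sum_const, Finset.card_univ, Fintype.card_fin, nsmul_eq_mul]
    ring

/-- The two hypotheses `(1, 0, …)` and `(1 - δ, δ, 0, …)`. -/
lemma ofReal_two_points_le_minimaxRisk {K n : ℕ} {α γ δ : ℝ} (hγ : 0 < γ) (hα : 0 < α)
    (hα1 : α < 1) (hK : 2 ≤ K) (hδ : 0 ≤ δ) (hδ1 : δ ≤ 1)
    (hn : n * privacyFactor α * (4 * δ ^ 2) ≤ 1 / 6) :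
    ENNReal.ofReal (((1 - δ) ^ γ + δ ^ γ - 1) ^ 2 / 16) ≤ minimaxRisk.{u} γ K n α := by
  obtain ⟨e⟩ : Nonempty (Bool ↪ Fin K) :=
    Function.Embedding.nonempty_of_card_le (by simpa using hK)
  let q : ℝ → Bool → ℝ := fun t b => if b then t else 1 - t
  have hsum : ∀ (G : Fin K → ℝ → ℝ), (∀ k, G k 0 = 0) → ∀ t,
      ∑ k, G k (Function.extend e (q t) 0 k) = G (e true) t + G (e false) (1 - t) := by
    intro G hG t
    rw [sum_extend_eq e (q t) G hG, Fintype.sum_bool]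
    simp [q]
  have hmem : ∀ t, 0 ≤ t → t ≤ 1 → Function.extend e (q t) 0 ∈ stdSimplex ℝ (Fin K) := by
    intro t ht0 ht1
    refine ⟨fun k => ?_, ?_⟩
    · by_cases h : ∃ o, e o = k
      · obtain ⟨o, rfl⟩ := h
        rw [e.injective.extend_apply]
        cases o <;> simp [q, ht0, ht1]
      · rw [Function.extend_apply' _ _ _ h]
        exact le_rfl
    · rw [hsum (fun _ t => t) fun _ => rfl]
      ring
  refine MeanSquareVariationLE.ofReal_le_minimaxRisk (Ω := Unit)
    (p₀ := Function.extend e (q 0) 0) (p := fun _ => Function.extend e (q δ) 0) hα hα1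
    (hmem 0 le_rfl zero_le_one) (fun _ => hmem δ hδ hδ1) (by positivity) ?_ hn
    fun _ => le_of_eq ?_
  · intro a ha
    simp only [sub_mul, Finset.sum_sub_distrib]
    rw [hsum (fun k t => t * a k) fun _ => zero_mul _,
      hsum (fun k t => t * a k) fun _ => zero_mul _]
    simp only [Finset.univ_unique, Finset.sum_singleton, Fintype.card_unit, Nat.cast_one, one_mul]
    have h1 := abs_le.1 (ha (e true))
    have h2 := abs_le.1 (ha (e false))
    have : (a (e true) - a (e false)) ^ 2 ≤ 2 ^ 2 := sq_le_sq' (by linarith) (by linarith)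
    nlinarith [sq_nonneg δ]
  · have h0 : (0 : ℝ) ^ γ = 0 := Real.zero_rpow hγ.ne'
    unfold powerSum
    rw [hsum (fun _ t => t ^ γ) fun _ => h0, hsum (fun _ t => t ^ γ) fun _ => h0]
    simp only [sub_zero, Real.one_rpow, h0]
    ring

/-! ### Choice of the perturbation size -/

/-- The bound from `m` pairs of cells, with the mass of a cell of order `(L T)^{-1/2}`. -/
lemma ofReal_rpow_div_rpow_le_minimaxRisk {K n m : ℕ} {α γ L T : ℝ} (hγ : 0 < γ) (hα : 0 < α)
    (hα1 : α < 1) (hm : 2 * m < K) (hL : 0 < L) (hmL : 2 * m ≤ L) (hLm : L ≤ 4 * m) (hLT : L ≤ T)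
    (hT : n * privacyFactor α ≤ T) :
    ENNReal.ofReal ((2 ^ γ - 2) ^ 2 / (256 * 25 ^ γ) * (L ^ (2 - γ) / T ^ γ))
      ≤ minimaxRisk.{u} γ K n α := by
  have hT0 : 0 < T := hL.trans_le hLT
  -- With `δ = 1/s`, `L ≤ T` gives `2mδ ≤ L/s ≤ 1`, and the entropy condition becomes `2/25 ≤ 1/6`.
  -- The lower bound `m ≥ L/4` yields `256 = 16 · 16`.
  set s : ℝ := 5 * Real.sqrt (L * T) with hs
  have hLT0 : 0 < L * T := mul_pos hL hT0
  have hs0 : 0 < s := by have := Real.sqrt_pos.2 hLT0; positivity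
  have hs2 : s ^ 2 = 25 * (L * T) := by
    rw [hs, mul_pow, Real.sq_sqrt hLT0.le]; norm_num
  have hLs : L ≤ s := by
    have : L ≤ Real.sqrt (L * T) := Real.le_sqrt_of_sq_le (by nlinarith)
    linarith
  have hδ2 : (s⁻¹) ^ 2 = (25 * (L * T))⁻¹ := by rw [inv_pow, hs2]
  refine le_trans (ENNReal.ofReal_le_ofReal ?_)
    (ofReal_pairs_le_minimaxRisk (δ := s⁻¹) hγ hα hα1 hm (by positivity) ?_ ?_)
  · have h1 : (s⁻¹ ^ γ) ^ 2 = (25 ^ γ * (L ^ γ * T ^ γ))⁻¹ := by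
      rw [← Real.rpow_natCast, ← Real.rpow_mul (by positivity), mul_comm γ,
        Real.rpow_mul (by positivity), Real.rpow_natCast, hδ2, Real.inv_rpow (by positivity),
        Real.mul_rpow (by positivity) (by positivity), Real.mul_rpow hL.le hT0.le]
    have h2 : L ^ (2 - γ) = L ^ 2 / L ^ γ := by
      rw [Real.rpow_sub hL, Real.rpow_two]
    have hLγ := Real.rpow_pos_of_pos hL γ
    have hTγ := Real.rpow_pos_of_pos hT0 γ
    have h25 : (0 : ℝ) < 25 ^ γ := by positivity
    rw [h2, mul_pow, mul_pow, h1]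
    calc (2 ^ γ - 2) ^ 2 / (256 * 25 ^ γ) * (L ^ 2 / L ^ γ / T ^ γ)
        ≤ (2 ^ γ - 2) ^ 2 / (256 * 25 ^ γ) * ((4 * m) ^ 2 / L ^ γ / T ^ γ) := by gcongr
      _ = _ := by field_simp; ring
  · rw [← div_eq_mul_inv, div_le_one hs0]
    linarith
  · rw [hδ2]
    have hP : 0 ≤ privacyFactor α := sq_nonneg _
    calc n * privacyFactor α * (4 * m * (25 * (L * T))⁻¹)
        ≤ T * (2 * L * (25 * (L * T))⁻¹) := by
          have : (4 * m : ℝ) ≤ 2 * L := by linarith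
          gcongr
      _ = 2 / 25 := by field_simp
      _ ≤ 1 / 6 := by norm_num

/-- For `0 < δ ≤ 1/20`, moving mass `δ` to an empty cell changes the power sum by order at least
`δ^γ`. -/
lemma le_sq_two_points_gap {γ δ : ℝ} (hγ1 : γ ≠ 1) (hδ : 0 < δ) (hδ1 : δ ≤ 1 / 20) :
    ((1 - (1 / 20 : ℝ) ^ |1 - γ|) * δ ^ γ) ^ 2 ≤ ((1 - δ) ^ γ + δ ^ γ - 1) ^ 2 := by
  have hpow : δ ^ |1 - γ| ≤ (1 / 20 : ℝ) ^ |1 - γ| :=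
    Real.rpow_le_rpow hδ.le hδ1 (abs_nonneg _)
  have hlt : (1 / 20 : ℝ) ^ |1 - γ| ≤ 1 :=
    Real.rpow_le_one (by norm_num) (by norm_num) (abs_nonneg _)
  have hδγ := Real.rpow_pos_of_pos hδ γ
  have h0 : 0 ≤ (1 - (1 / 20 : ℝ) ^ |1 - γ|) * δ ^ γ :=
    mul_nonneg (by linarith) hδγ.le
  rcases lt_or_gt_of_ne hγ1 with h | h
  -- For `γ < 1` the gap is at least `δ^γ - δ = δ^γ (1 - δ^{1-γ})`.
  · rw [abs_of_pos (by linarith : 0 < 1 - γ)] at *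
    have h1 : 1 - δ ≤ (1 - δ) ^ γ := by
      have := Real.rpow_le_rpow_of_exponent_ge (by linarith : 0 < 1 - δ) (by linarith) h.le
      rwa [Real.rpow_one] at this
    have h2 : δ = δ ^ γ * δ ^ (1 - γ) := by
      rw [← Real.rpow_add hδ]; simp
    have h3 : δ ^ γ * δ ^ (1 - γ) ≤ δ ^ γ * (1 / 20) ^ (1 - γ) := by gcongr
    refine pow_le_pow_left₀ h0 ?_ 2
    linarith
  -- For `γ > 1` the gap is negative, of size at least `δ - δ^γ = δ (1 - δ^{γ-1})`, and `δ ≥ δ^γ`.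
  · rw [abs_of_neg (by linarith : 1 - γ < 0), neg_sub] at *
    have h1 : (1 - δ) ^ γ ≤ 1 - δ := by
      have := Real.rpow_le_rpow_of_exponent_ge (by linarith : 0 < 1 - δ) (by linarith) h.le
      rwa [Real.rpow_one] at this
    have h2 : δ ^ γ = δ * δ ^ (γ - 1) := by
      rw [← Real.rpow_one_add' hδ.le (by linarith)]; simp
    have h3 : δ * δ ^ (γ - 1) ≤ δ * (1 / 20) ^ (γ - 1) := by gcongr
    have h4 : δ ^ γ ≤ δ := by
      have := Real.rpow_le_rpow_of_exponent_ge hδ (by linarith) h.le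
      rwa [Real.rpow_one] at this
    have h5 : (1 - (1 / 20 : ℝ) ^ (γ - 1)) * δ ^ γ ≤ (1 - (1 / 20 : ℝ) ^ (γ - 1)) * δ := by
      gcongr
    rw [← neg_sq ((1 - δ) ^ γ + δ ^ γ - 1)]
    refine pow_le_pow_left₀ h0 ?_ 2
    linarith

/-- Serves `K = 2`, where `K^{2-γ}` is a constant. The mass moved is `1 / (5 √N)`, at most `1/20`
because `N ≥ 16`. -/
lemma ofReal_div_rpow_le_minimaxRisk {K n : ℕ} {α γ : ℝ} (hγ : 0 < γ) (hγ1 : γ ≠ 1) (hα : 0 < α)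
    (hα1 : α < 1) (hK : 2 ≤ K) (hN : 16 ≤ n * privacyFactor α) :
    ENNReal.ofReal ((1 - (1 / 20 : ℝ) ^ |1 - γ|) ^ 2 / (16 * 25 ^ γ)
        * (1 / (n * privacyFactor α) ^ γ)) ≤ minimaxRisk.{u} γ K n α := by
  set N := n * privacyFactor α with hNdef
  have hN0 : 0 < N := by linarith
  set s : ℝ := 5 * Real.sqrt N with hs
  have hs20 : 20 ≤ s := by
    have : 4 ≤ Real.sqrt N := Real.le_sqrt_of_sq_le (by linarith)
    linarith
  have hs0 : 0 < s := by linarith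
  have hδ2 : (s⁻¹) ^ 2 = (25 * N)⁻¹ := by
    rw [inv_pow, hs, mul_pow, Real.sq_sqrt hN0.le]; norm_num
  have hδ : s⁻¹ ≤ 1 / 20 := by
    rw [one_div]; exact inv_anti₀ (by norm_num) hs20
  refine le_trans (ENNReal.ofReal_le_ofReal ?_)
    (ofReal_two_points_le_minimaxRisk (δ := s⁻¹) hγ hα hα1 hK (by positivity) (by linarith) ?_)
  · have h1 : (s⁻¹ ^ γ) ^ 2 = (25 ^ γ * N ^ γ)⁻¹ := by
      rw [← Real.rpow_natCast, ← Real.rpow_mul (by positivity), mul_comm γ,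
        Real.rpow_mul (by positivity), Real.rpow_natCast, hδ2, Real.inv_rpow (by positivity),
        Real.mul_rpow (by positivity) (by positivity)]
    have h2 := le_sq_two_points_gap hγ1 (inv_pos.2 hs0) hδ
    rw [mul_pow, h1] at h2
    calc _ = (1 - (1 / 20 : ℝ) ^ |1 - γ|) ^ 2 * (25 ^ γ * N ^ γ)⁻¹ / 16 := by field_simp
      _ ≤ _ := by gcongr
  · rw [hδ2, ← hNdef]
    calc N * (4 * (25 * N)⁻¹) = 4 / 25 := by field_simp
      _ ≤ 1 / 6 := by norm_num

lemma sixteen_le_mul_privacyFactor {n : ℕ} {α : ℝ} (hα : 0 < α) (h : 1 ≤ α ^ 2 * (n : ℝ)) :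
    16 ≤ n * privacyFactor α := by
  have := mul_le_mul_of_nonneg_left (sixteen_mul_sq_le_privacyFactor hα)
    (Nat.cast_nonneg (α := ℝ) n)
  linarith

/-! ### The constant and the regimes of `K` and `N` -/

/-- The constant in the lower bound on the minimax risk. -/
noncomputable def riskConst (γ : ℝ) : ℝ :=
  min ((2 ^ γ - 2) ^ 2 / (256 * 25 ^ γ))
    ((1 - (1 / 20 : ℝ) ^ |1 - γ|) ^ 2 / (16 * 25 ^ γ) / 2 ^ (2 - γ))

lemma riskConst_pos {γ : ℝ} (hγ1 : γ ≠ 1) : 0 < riskConst γ := by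
  have h1 : (2 : ℝ) ^ γ - 2 ≠ 0 := by
    intro h
    have h' : (2 : ℝ) ^ γ = 2 ^ (1 : ℝ) := by rw [Real.rpow_one]; linarith
    exact hγ1 ((Real.rpow_right_inj two_pos (by norm_num)).1 h')
  have h2 : (1 / 20 : ℝ) ^ |1 - γ| < 1 :=
    Real.rpow_lt_one (by norm_num) (by norm_num) (abs_pos.2 (sub_ne_zero.2 hγ1.symm))
  have h3 : 0 < 1 - (1 / 20 : ℝ) ^ |1 - γ| := by linarith
  unfold riskConst
  refine lt_min ?_ ?_ <;> positivity

/-- The two cells of `K = 2`. -/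
lemma ofReal_riskConst_mul_le_minimaxRisk_two {n : ℕ} {α γ : ℝ}
    (hγ : 0 < γ) (hγ1 : γ ≠ 1) (hα : 0 < α)
    (hα1 : α < 1) (hN : 16 ≤ n * privacyFactor α) :
    ENNReal.ofReal (riskConst γ * (2 ^ (2 - γ) / (n * privacyFactor α) ^ γ))
      ≤ minimaxRisk.{u} γ 2 n α := by
  refine le_trans (ENNReal.ofReal_le_ofReal ?_)
    (ofReal_div_rpow_le_minimaxRisk hγ hγ1 hα hα1 le_rfl hN)
  have hNγ : 0 < (n * privacyFactor α) ^ γ := Real.rpow_pos_of_pos (by linarith) γ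
  -- The factor `2 ^ (2 - γ)` in the constant absorbs `K^{2-γ}` at `K = 2`.
  calc _ ≤ (1 - (1 / 20 : ℝ) ^ |1 - γ|) ^ 2 / (16 * 25 ^ γ) / 2 ^ (2 - γ)
        * (2 ^ (2 - γ) / (n * privacyFactor α) ^ γ) := by
        gcongr
        exact min_le_right _ _
    _ = _ := by field_simp

lemma ofReal_riskConst_mul_le_minimaxRisk_of_pairs {K n m : ℕ} {α γ L T : ℝ}
    (hγ : 0 < γ) (hα : 0 < α)
    (hα1 : α < 1) (hm : 2 * m < K) (hL : 0 < L) (hmL : 2 * m ≤ L) (hLm : L ≤ 4 * m) (hLT : L ≤ T)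
    (hT : n * privacyFactor α ≤ T) :
    ENNReal.ofReal (riskConst γ * (L ^ (2 - γ) / T ^ γ)) ≤ minimaxRisk.{u} γ K n α := by
  refine le_trans (ENNReal.ofReal_le_ofReal ?_)
    (ofReal_rpow_div_rpow_le_minimaxRisk hγ hα hα1 hm hL hmL hLm hLT hT)
  have hT0 : 0 < T := hL.trans_le hLT
  gcongr
  exact min_le_left _ _

/-- For `K ≤ N`, where `N = n (e^{2α} - e^{-2α})²`, both regimes have the same lower bound. -/
lemma ofReal_riskConst_mul_le_minimaxRisk_of_le {K n : ℕ} {α γ : ℝ}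
    (hγ : 0 < γ) (hγ1 : γ ≠ 1) (hα : 0 < α)
    (hα1 : α < 1) (hK : 2 ≤ K) (hN : 16 ≤ n * privacyFactor α)
    (hKN : (K : ℝ) ≤ n * privacyFactor α) :
    ENNReal.ofReal (riskConst γ * ((K : ℝ) ^ (2 - γ) / (n * privacyFactor α) ^ γ))
      ≤ minimaxRisk.{u} γ K n α := by
  rcases hK.eq_or_lt with rfl | hK
  · exact_mod_cast ofReal_riskConst_mul_le_minimaxRisk_two hγ hγ1 hα hα1 hN
  -- The largest `m` with `2m < K`; it satisfies `K ≤ 4m` as soon as `K ≥ 3`.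
  · refine ofReal_riskConst_mul_le_minimaxRisk_of_pairs (m := (K - 1) / 2) hγ hα hα1 (by omega)
      (by exact_mod_cast (by omega : 0 < K)) ?_ ?_ hKN le_rfl
    · exact_mod_cast (by omega : 2 * ((K - 1) / 2) ≤ K)
    · exact_mod_cast (by omega : K ≤ 4 * ((K - 1) / 2))

end LDP

theorem theorem5p2 :
    (∀ γ : ℝ, 0 < γ → γ < 1 → ∃ c : ℝ, 0 < c ∧
      ∀ (K n : ℕ) (α : ℝ), 2 ≤ K → 0 < α → α < 1 → 1 ≤ α ^ 2 * (n : ℝ) →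
        ENNReal.ofReal (c * min ((K : ℝ) ^ (2 * (1 - γ)))
            ((K : ℝ) ^ (2 - γ) / ((n : ℝ) * LDP.privacyFactor α) ^ γ))
          ≤ LDP.minimaxRisk.{u} γ K n α) ∧
    (∀ γ : ℝ, 1 < γ → γ < 2 → ∃ c : ℝ, 0 < c ∧
      ∀ (K n : ℕ) (α : ℝ), 2 ≤ K → 0 < α → α < 1 → 1 ≤ α ^ 2 * (n : ℝ) →
        ENNReal.ofReal (c * min (1 / (LDP.privacyFactor α * (n : ℝ)) ^ (2 * (γ - 1)))
            ((K : ℝ) ^ (2 - γ) / (LDP.privacyFactor α * (n : ℝ)) ^ γ))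
          ≤ LDP.minimaxRisk.{u} γ K n α) := by
  refine ⟨fun γ hγ hγ1 => ⟨LDP.riskConst γ, LDP.riskConst_pos hγ1.ne, ?_⟩,
    fun γ hγ hγ2 => ⟨LDP.riskConst γ, LDP.riskConst_pos hγ.ne', ?_⟩⟩
  · intro K n α hK hα hα1 hn
    have hc := LDP.riskConst_pos hγ1.ne
    have hN := LDP.sixteen_le_mul_privacyFactor hα hn
    rcases le_total (K : ℝ) (n * LDP.privacyFactor α) with hKN | hKN
    · refine le_trans (ENNReal.ofReal_le_ofReal ?_)
        (LDP.ofReal_riskConst_mul_le_minimaxRisk_of_le hγ hγ1.ne hα hα1 hK hN hKN)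
      gcongr
      exact min_le_right _ _
    · have hK3 : 2 < K := by
        have : (2 : ℝ) < K := by linarith
        exact_mod_cast this
      have hK0 : (0 : ℝ) < K := by linarith
      -- All cells are used, and `T = K ≥ N` keeps `δ` of order `1/K`, so that the total mass fits;
      -- the rate is `K^{2-γ} / K^γ`.
      refine le_trans (ENNReal.ofReal_le_ofReal ?_)
        (LDP.ofReal_riskConst_mul_le_minimaxRisk_of_pairs (m := (K - 1) / 2) (L := K) (T := K)
          hγ hα hα1 (by omega) hK0
          (by exact_mod_cast (by omega : 2 * ((K - 1) / 2) ≤ K))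
          (by exact_mod_cast (by omega : K ≤ 4 * ((K - 1) / 2))) le_rfl hKN)
      gcongr
      refine (min_le_left _ _).trans_eq ?_
      rw [← Real.rpow_sub hK0]
      congr 1; ring
  · intro K n α hK hα hα1 hn
    have hγ0 : 0 < γ := by linarith
    have hc := LDP.riskConst_pos hγ.ne'
    have hN := LDP.sixteen_le_mul_privacyFactor hα hn
    rw [mul_comm (LDP.privacyFactor α)]
    rcases le_total (K : ℝ) (n * LDP.privacyFactor α) with hKN | hKN
    · refine le_trans (ENNReal.ofReal_le_ofReal ?_)
        (LDP.ofReal_riskConst_mul_le_minimaxRisk_of_le hγ0 hγ.ne' hα hα1 hK hN hKN)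
      gcongr
      exact min_le_right _ _
    -- For `γ > 1` spreading the mass over more than about `N` cells shrinks the gap, so only `⌊N⌋₊`
    -- cells are counted; `L = T = N` gives the rate `N^{2-2γ}`.
    · set N := n * LDP.privacyFactor α with hNdef
      have hN0 : 0 < N := by linarith
      have hfl : (⌊N⌋₊ : ℝ) ≤ N := Nat.floor_le hN0.le
      have hfl' : N < ⌊N⌋₊ + 1 := Nat.lt_floor_add_one N
      have hf16 : 16 ≤ ⌊N⌋₊ := Nat.le_floor (by exact_mod_cast hN)
      have hfK : ⌊N⌋₊ ≤ K := by exact_mod_cast hfl.trans hKN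
      have hm1 : (2 * ((⌊N⌋₊ - 1) / 2 : ℕ) : ℝ) ≤ ⌊N⌋₊ := by
        exact_mod_cast (by omega : 2 * ((⌊N⌋₊ - 1) / 2) ≤ ⌊N⌋₊)
      have hm2 : (⌊N⌋₊ + 1 : ℝ) ≤ 4 * ((⌊N⌋₊ - 1) / 2 : ℕ) := by
        exact_mod_cast (by omega : ⌊N⌋₊ + 1 ≤ 4 * ((⌊N⌋₊ - 1) / 2))
      refine le_trans (ENNReal.ofReal_le_ofReal ?_)
        (LDP.ofReal_riskConst_mul_le_minimaxRisk_of_pairs (m := (⌊N⌋₊ - 1) / 2) (L := N) (T := N)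
          hγ0 hα hα1 (by omega) hN0
          (by linarith) (by linarith) le_rfl le_rfl)
      gcongr
      refine (min_le_left _ _).trans_eq ?_
      rw [← Real.rpow_sub hN0, one_div, ← Real.rpow_neg hN0.le]
      congr 1; ring
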